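/- A storage system has $n\ge 1$ nodes; every object has one fragment on each node, and $r\ge 0$ is an integer. Node failures form a time-invariant Poisson process: starting from time $0$, the interarrival times of failures are independent exponential variables of rate $\lambda n$ ($\lambda>0$ is the failure rate per node), and the failing nodes are uniform on the $n$ nodes, independent of each other and of the times. Objects occupy positions $x\in[0,1]$ of a repair queue (in the limit of infinitely many objects): an object at position $0$ has just been repaired, an object reaching position $1$ is repaired completely and re-enters at $0$. When a node fails, every object loses its fragment on that node if it still has it. The repair rate is regulated with a fixed assumed node failure rate $\hat\lambda>0$, which may or may not equal $\lambda$, through a function $\phi(f,x)$ on $[0,1]^2$ that is bounded below by a positive constant, non-increasing in $f$ and non-decreasing in $x$: if $f(x,t)$ is the fraction of erased fragments of the object at position $x$ at time $t$, then all objects advance at time $t$ with the speed $\bigl(\inf_{x\in[0,1]}\hat\lambda^{-1}\phi(f(x,t),x)\bigr)^{-1}$. Let $T=\hat\lambda^{-1}\phi(0,0)$, which is an upper bound on the time between consecutive repairs of an object. Let $\mathrm{MTTDL}\in[0,\infty]$ be the expected time, starting from the perfect queue (no erased fragments) at time $0$, until some object has $r+1$ erased fragments before its repair is completed. For a node failure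 time $s$, consider an object that is at position $0$ immediately before $s$ and from then on alone determines the repair rate: its position $y(t)$, $t\ge s$, satisfies $y(s)=0$ and $y'(t)=\hat\lambda/\phi(F(t)/n,y(t))$, where $F(t)$ is the number of distinct nodes failing in $[s,t]$ (including the failure at $s$), until the time $\tau$ at which $y(\tau)=1$. Let $q$ be the distribution of $F(\tau)$ (it is the same for every failure), and $q(>r)=\sum_{j>r}q(j)$. Then $$\frac{1}{\lambda\, n\, q(>r)}-T\;\le\;\mathrm{MTTDL},$$ where the left-hand side is read as $+\infty$ if $q(>r)=0$. -/

import Mathlib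

open MeasureTheory ProbabilityTheory

namespace RegulatedRepair

/-- Motion along a line, started at `a`, whose pace (time per unit of length) at the point `u` is
`g u`: `advance g a t` is the point reached after the elapsed time `t ≥ 0`. It is given by
separation of variables, i.e. it is the point `b` with `∫ u in a..b, g u = t`.
For a positive non-decreasing pace it is the solution of `y' = 1 / g y`, `y 0 = a`: see
`advance_zero`, `continuousOn_advance` and `advance_eq_integral` below. -/
noncomputable def advance (g : ℝ → ℝ) (a t : ℝ) : ℝ :=
  sSup {b : ℝ | a ≤ b ∧ ∫ u in a..b, g u ≤ t}

section AdvanceSolves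

theorem pace_integrable {g : ℝ → ℝ} {a : ℝ} (hg : MonotoneOn g (Set.Ici a)) {b c : ℝ}
    (hb : a ≤ b) (hc : a ≤ c) : IntervalIntegrable g volume b c :=
  (hg.mono fun _ hx => le_trans (le_min hb hc) hx.1).intervalIntegrable

theorem pace_lower {g : ℝ → ℝ} {a m : ℝ} (hg : MonotoneOn g (Set.Ici a))
    (hm : ∀ u, a ≤ u → m ≤ g u) {b c : ℝ} (hb : a ≤ b) (hbc : b ≤ c) :
    m * (c - b) ≤ (∫ u in a..c, g u) - ∫ u in a..b, g u := by
  have hc := hb.trans hbc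
  rw [intervalIntegral.integral_interval_sub_left (pace_integrable hg le_rfl hc)
    (pace_integrable hg le_rfl hb)]
  have h := intervalIntegral.integral_mono_on (f := fun _ => m) (g := g) (μ := volume) hbc
    (by simp) (pace_integrable hg hb hc) (fun x hx => hm x (hb.trans hx.1))
  simpa [mul_comm] using h

/-- The defining property: the travel time from `a` to `advance g a t` is `t`. -/
theorem advance_travel_time {g : ℝ → ℝ} {a m : ℝ} (hg : MonotoneOn g (Set.Ici a)) (hm0 : 0 < m)
    (hm : ∀ u, a ≤ u → m ≤ g u) {t : ℝ} (ht : 0 ≤ t) :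
    a ≤ advance g a t ∧ ∫ u in a..advance g a t, g u = t := by
  have hB : a ≤ a + t / m := by have := div_nonneg ht hm0.le; linarith
  have hcont : ContinuousOn (fun b => ∫ u in a..b, g u) (Set.Icc a (a + t / m)) := by
    have := intervalIntegral.continuousOn_primitive_interval
      ((pace_integrable hg le_rfl hB).1.congr_set_ae
        (Ioc_ae_eq_Icc (μ := volume) (a := a) (b := a + t / m)).symm |> fun h => by
          simpa [Set.uIcc_of_le hB] using h : IntegrableOn g (Set.uIcc a (a + t / m)) volume)
    simpa [Set.uIcc_of_le hB] using this
  have htop : t ≤ ∫ u in a..(a + t / m), g u := by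
    have h := pace_lower hg hm le_rfl hB
    have h2 : m * (a + t / m - a) = t := by field_simp; ring
    simp only [intervalIntegral.integral_same, sub_zero] at h
    linarith
  obtain ⟨b, hb, hbt⟩ := intermediate_value_Icc hB hcont
    (show t ∈ Set.Icc (∫ u in a..a, g u) _ from ⟨by simpa using ht, htop⟩)
  have hlub : IsGreatest {b : ℝ | a ≤ b ∧ ∫ u in a..b, g u ≤ t} b := by
    refine ⟨⟨hb.1, hbt.le⟩, fun c hc => ?_⟩
    by_contra! hlt
    have h := pace_lower hg hm hb.1 hlt.le
    have h3 : 0 < m * (c - b) := mul_pos hm0 (by linarith)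
    have h4 := hc.2
    simp only at hbt
    linarith
  have : advance g a t = b := hlub.csSup_eq
  rw [this]
  exact ⟨hb.1, hbt⟩

theorem advance_zero {g : ℝ → ℝ} {a m : ℝ} (hg : MonotoneOn g (Set.Ici a)) (hm0 : 0 < m)
    (hm : ∀ u, a ≤ u → m ≤ g u) : advance g a 0 = a := by
  obtain ⟨h1, h2⟩ := advance_travel_time hg hm0 hm le_rfl
  have h := pace_lower hg hm le_rfl h1
  simp only [intervalIntegral.integral_same, sub_zero, h2] at h
  nlinarith

theorem advance_lipschitz {g : ℝ → ℝ} {a m : ℝ} (hg : MonotoneOn g (Set.Ici a)) (hm0 : 0 < m)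
    (hm : ∀ u, a ≤ u → m ≤ g u) {s t : ℝ} (hs : 0 ≤ s) (hst : s ≤ t) :
    advance g a s ≤ advance g a t ∧ m * (advance g a t - advance g a s) ≤ t - s := by
  obtain ⟨h1, h2⟩ := advance_travel_time hg hm0 hm hs
  obtain ⟨h3, h4⟩ := advance_travel_time hg hm0 hm (hs.trans hst)
  have hle : advance g a s ≤ advance g a t := by
    by_contra! hlt
    have h := pace_lower hg hm h3 hlt.le
    have h5 : 0 < m * (advance g a s - advance g a t) := mul_pos hm0 (by linarith)
    linarith
  exact ⟨hle, by have h := pace_lower hg hm h1 hle; linarith⟩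

theorem continuousOn_advance {g : ℝ → ℝ} {a m : ℝ} (hg : MonotoneOn g (Set.Ici a)) (hm0 : 0 < m)
    (hm : ∀ u, a ≤ u → m ≤ g u) : ContinuousOn (advance g a) (Set.Ici 0) := by
  have : LipschitzOnWith (Real.toNNReal (1 / m)) (advance g a) (Set.Ici 0) := by
    refine LipschitzOnWith.of_le_add_mul' _ fun s hs t ht => ?_
    rcases le_total s t with h | h
    · have := (advance_lipschitz hg hm0 hm hs h).1
      have : 0 ≤ 1 / m * dist s t := by positivity
      linarith
    · have := (advance_lipschitz hg hm0 hm ht h).2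
      rw [Real.dist_eq, abs_of_nonneg (by linarith), div_mul_eq_mul_div, one_mul]
      have : advance g a s - advance g a t ≤ (s - t) / m := by
        rw [le_div_iff₀ hm0]; linarith
      linarith
  exact this.continuousOn

/-- `advance g a` solves `y' = 1 / g y`, `y 0 = a` (in integrated form). -/
theorem advance_eq_integral {g : ℝ → ℝ} {a m : ℝ} (hg : MonotoneOn g (Set.Ici a)) (hm0 : 0 < m)
    (hm : ∀ u, a ≤ u → m ≤ g u) {t : ℝ} (ht : 0 ≤ t) :
    advance g a t = a + ∫ s in (0 : ℝ)..t, 1 / g (advance g a s) := by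
  have hpos : ∀ s, 0 ≤ s → a ≤ advance g a s := fun s hs => (advance_travel_time hg hm0 hm hs).1
  have hcont := continuousOn_advance hg hm0 hm
  let G : ℝ → ℝ := fun u => g (max u a)
  have hG : Monotone G := fun x y h =>
    hg (Set.mem_Ici.2 (le_max_right _ _)) (Set.mem_Ici.2 (le_max_right _ _)) (max_le_max_right a h)
  have hinj : Set.InjOn (advance g a) (Set.Ici 0) := fun x hx y hy h => by
    rw [← (advance_travel_time hg hm0 hm hx).2, h, (advance_travel_time hg hm0 hm hy).2]
  have hcount : ({s | ¬ ContinuousAt G (advance g a s)} ∩ Set.Ici 0).Countable := by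
    have h1 := hG.countable_not_continuousAt
    have := Set.MapsTo.countable_of_injOn (f := advance g a)
      (s := {s | ¬ ContinuousAt G (advance g a s)} ∩ Set.Ici 0)
      (t := {x | ¬ ContinuousAt G x}) (fun s hs => hs.1) (hinj.mono Set.inter_subset_right) h1
    exact this
  have hint : IntervalIntegrable (fun s => 1 / g (advance g a s)) volume 0 t := by
    apply AntitoneOn.intervalIntegrable
    rw [Set.uIcc_of_le ht]
    intro x hx y hy hxy
    refine one_div_le_one_div_of_le (hm0.trans_le (hm _ (hpos x hx.1))) ?_
    exact hg (hpos x hx.1) (hpos y hy.1) (advance_lipschitz hg hm0 hm hx.1 hxy).1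
  have key := integral_eq_of_hasDerivAt_off_countable_of_le (advance g a)
    (fun s => 1 / g (advance g a s)) ht hcount (hcont.mono Set.Icc_subset_Ici_self) ?_ hint
  · rw [key, advance_zero hg hm0 hm]; ring
  · intro s hs
    have hs0 : 0 < s := hs.1.1
    have hGc : ContinuousAt G (advance g a s) := by
      by_contra hcon
      exact hs.2 ⟨hcon, hs0.le⟩
    have hlt : a < advance g a s := by
      refine lt_of_le_of_ne (hpos s hs0.le) fun h => ?_
      have h2 := (advance_travel_time hg hm0 hm hs0.le).2
      rw [← h] at h2
      simp at h2
      linarith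
    have hev : G =ᶠ[nhds (advance g a s)] g := by
      filter_upwards [lt_mem_nhds hlt] with x hx
      simp [G, max_eq_left hx.le]
    have hgc : ContinuousAt g (advance g a s) := hGc.congr hev
    have hmeas : StronglyMeasurableAtFilter g (nhds (advance g a s)) :=
      ⟨Set.Ioi a, lt_mem_nhds hlt,
        (aemeasurable_restrict_of_monotoneOn measurableSet_Ioi
          (hg.mono Set.Ioi_subset_Ici_self)).aestronglyMeasurable⟩
    have hder := intervalIntegral.integral_hasDerivAt_right
      (pace_integrable hg le_rfl hlt.le) hmeas hgc
    rw [one_div]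
    refine HasDerivAt.of_local_left_inverse (hcont.continuousAt (Ici_mem_nhds hs0)) hder
      (hm0.trans_le (hm _ hlt.le)).ne' ?_
    filter_upwards [lt_mem_nhds hs0] with x hx
    exact (advance_travel_time hg hm0 hm hx.le).2

end AdvanceSolves

/-- A repair queue (in the limit of infinitely many objects): for each position `x ∈ [0, 1]`, where
`0` is the tail (just repaired) and `1` is the head (repair completed), the set of nodes whose
fragment of the object in position `x` is erased. Values outside `[0, 1]` play no role. -/
abbrev QueueState (n : ℕ) := ℝ → Finset (Fin n)

/-- The queue after every object has advanced by `d`: the objects that left at the head have been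
repaired, and fully repaired objects fill the positions in `[0, d)`. -/
noncomputable def QueueState.shift {n : ℕ} (S : QueueState n) (d : ℝ) : QueueState n :=
  fun x => if x < d then ∅ else S (x - d)

/-- The system repair time in force: the smallest of the times `φ (f x) x / mu` requested by the
objects of the queue, where `f x` is the fraction of erased fragments in position `x` and `mu` is
the assumed (estimated) node failure rate. -/
noncomputable def systemRepairTime {n : ℕ} (φ : ℝ → ℝ → ℝ) (mu : ℝ) (S : QueueState n) : ℝ :=
  ⨅ x : Set.Icc (0 : ℝ) 1, φ ((S x).card / n) x / mu

/-- The distance by which all objects of the queue advance during a time `t` without node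
failures: the solution `d` of `d' = 1 / systemRepairTime (S.shift d)`, `d 0 = 0`. -/
noncomputable def displacement {n : ℕ} (φ : ℝ → ℝ → ℝ) (mu : ℝ) (S : QueueState n) (t : ℝ) : ℝ :=
  advance (fun d => systemRepairTime φ mu (S.shift d)) 0 t

/-- The pace of the queue between two node failures is non-decreasing and bounded below by a
positive constant, so that `displacement` is the solution of its differential equation. -/
theorem systemRepairTime_shift {n : ℕ} {φ : ℝ → ℝ → ℝ} {mu c : ℝ} (hmu : 0 < mu)
    (hlow : ∀ f ∈ Set.Icc (0 : ℝ) 1, ∀ x ∈ Set.Icc (0 : ℝ) 1, c ≤ φ f x)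
    (hf : ∀ x ∈ Set.Icc (0 : ℝ) 1, AntitoneOn (fun f => φ f x) (Set.Icc 0 1))
    (hx : ∀ f ∈ Set.Icc (0 : ℝ) 1, MonotoneOn (fun x => φ f x) (Set.Icc 0 1))
    (S : QueueState n) :
    MonotoneOn (fun d => systemRepairTime φ mu (S.shift d)) (Set.Ici 0) ∧
      ∀ d, c / mu ≤ systemRepairTime φ mu (S.shift d) := by
  have hfrac : ∀ A : Finset (Fin n), ((A.card : ℝ) / n) ∈ Set.Icc (0 : ℝ) 1 := fun A =>
    ⟨by positivity, div_le_one_of_le₀ (by exact_mod_cast card_finset_fin_le A) (by positivity)⟩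
  have h0 : (0 : ℝ) ∈ Set.Icc (0 : ℝ) 1 := by simp
  have hbdd : ∀ d, BddBelow (Set.range fun x : Set.Icc (0 : ℝ) 1 =>
      φ (((S.shift d) x).card / n) x / mu) := fun d => by
    refine ⟨c / mu, ?_⟩
    rintro _ ⟨x, rfl⟩
    exact div_le_div_of_nonneg_right (hlow _ (hfrac _) _ x.2) hmu.le
  have hne : Nonempty (Set.Icc (0 : ℝ) 1) := ⟨⟨0, h0⟩⟩
  refine ⟨fun d hd e he hde => ?_, fun d =>
    le_ciInf fun x => div_le_div_of_nonneg_right (hlow _ (hfrac _) _ x.2) hmu.le⟩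
  rw [Set.mem_Ici] at hd he
  refine le_ciInf fun x => ?_
  obtain ⟨x, hx01⟩ := x
  simp only [QueueState.shift]
  split_ifs with h
  · have h2 := ciInf_le (hbdd d) ⟨0, h0⟩
    refine h2.trans (div_le_div_of_nonneg_right ?_ hmu.le)
    simp only [Finset.card_empty, Nat.cast_zero, zero_div]
    refine le_trans (b := φ 0 0) ?_ (hx 0 h0 h0 hx01 hx01.1)
    exact hf 0 h0 h0 (hfrac _) (hfrac _).1
  · push Not at h
    have hmem : x - e + d ∈ Set.Icc (0 : ℝ) 1 := ⟨by linarith, by linarith [hx01.2]⟩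
    have h2 := ciInf_le (hbdd d) ⟨x - e + d, hmem⟩
    refine h2.trans (div_le_div_of_nonneg_right ?_ hmu.le)
    have h3 : ¬ (x - e + d < d) := by push Not; linarith
    simp only [QueueState.shift, h3, if_false, add_sub_cancel_right]
    exact hx _ (hfrac _) hmem hx01 (by linarith)

/-- The node failures (numbered from `0`): `gap 0` is the time of failure number `0`, `gap (k + 1)`
is the time between failures number `k` and `k + 1`, and `node k` is the node that fails. -/
noncomputable def failureTime (gap : ℕ → ℝ) (k : ℕ) : ℝ := ∑ j ∈ Finset.range (k + 1), gap j

/-- The queue after the first `k` node failures, from a perfect queue at time `0`: the queue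
advances until the next failure, and then each object loses its fragment on the failing node. -/
noncomputable def queueAfter {n : ℕ} (φ : ℝ → ℝ → ℝ) (mu : ℝ) (gap : ℕ → ℝ) (node : ℕ → Fin n) :
    ℕ → QueueState n
  | 0 => fun _ => ∅
  | k + 1 => fun x => insert (node k)
      ((queueAfter φ mu gap node k).shift
        (displacement φ mu (queueAfter φ mu gap node k) (gap k)) x)

/-- Failure number `k` leaves an object of the queue, whose repair is not completed, with at least
`r + 1` erased fragments. -/
def IsDataLoss {n : ℕ} (φ : ℝ → ℝ → ℝ) (mu : ℝ) (gap : ℕ → ℝ) (node : ℕ → Fin n) (r k : ℕ) :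
    Prop :=
  ∃ x ∈ Set.Ico (0 : ℝ) 1, r + 1 ≤ (queueAfter φ mu gap node (k + 1) x).card

/-- The time of the first data loss (`⊤` if there is none). -/
noncomputable def dataLossTime {n : ℕ} (φ : ℝ → ℝ → ℝ) (mu : ℝ) (gap : ℕ → ℝ)
    (node : ℕ → Fin n) (r : ℕ) : ENNReal :=
  ⨅ (k : ℕ) (_ : IsDataLoss φ mu gap node r k), ENNReal.ofReal (failureTime gap k)

/-- The mean time to data loss, from a perfect queue. -/
noncomputable def mttdl {Ω : Type*} [MeasurableSpace Ω] (P : Measure Ω) {n : ℕ}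
    (φ : ℝ → ℝ → ℝ) (mu : ℝ) (gap : ℕ → Ω → ℝ) (node : ℕ → Ω → Fin n) (r : ℕ) : ENNReal :=
  ∫⁻ ω, dataLossTime φ mu (fun k => gap k ω) (fun k => node k ω) r ∂P

/-- The set of distinct nodes among the failures number `i, …, i + m`. -/
def nodesSeen {n : ℕ} (node : ℕ → Fin n) (i m : ℕ) : Finset (Fin n) :=
  (Finset.range (m + 1)).image fun j => node (i + j)

/-- The greedy critical object of failure number `i` is at the tail of the queue immediately before
that failure, sees it, and then controls the repair rate alone until it reaches position `1`:
with `F` distinct failures seen so far, its position solves `y' = mu / φ (F / n) y`.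
`greedyPosition … i m` is its position at failure number `i + m`. Once it has reached position `1`
its further motion is irrelevant (`φ` is frozen at its value in position `1`). -/
noncomputable def greedyPosition {n : ℕ} (φ : ℝ → ℝ → ℝ) (mu : ℝ) (gap : ℕ → ℝ)
    (node : ℕ → Fin n) (i : ℕ) : ℕ → ℝ
  | 0 => 0
  | m + 1 => advance (fun y => φ ((nodesSeen node i m).card / n) (min y 1) / mu)
      (greedyPosition φ mu gap node i m) (gap (i + m + 1))

/-- The number of distinct node failures, failure number `i` included, that the greedy critical
object of failure number `i` sees before it reaches the head of the queue. -/
noncomputable def greedyCount {n : ℕ} (φ : ℝ → ℝ → ℝ) (mu : ℝ) (gap : ℕ → ℝ)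
    (node : ℕ → Fin n) (i : ℕ) : ℕ :=
  Set.ncard {v : Fin n | ∃ m, greedyPosition φ mu gap node i m < 1 ∧ node (i + m) = v}

/-- The distribution `q` of the number of distinct failures seen by the greedy critical object of
failure number `i`. -/
noncomputable def greedyDistribution {Ω : Type*} [MeasurableSpace Ω] (P : Measure Ω) {n : ℕ}
    (φ : ℝ → ℝ → ℝ) (mu : ℝ) (gap : ℕ → Ω → ℝ) (node : ℕ → Ω → Fin n) (i : ℕ) : Measure ℕ :=
  P.map fun ω => greedyCount φ mu (fun k => gap k ω) (fun k => node k ω) i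

/-- Time-invariant Poisson node failures at rate `lam` per node: the times between successive
failures of the `n` nodes are exponential with rate `lam * n`, the failing nodes are uniform, and
all these variables are independent. -/
structure IsPoissonFailures {Ω : Type*} [MeasurableSpace Ω] (P : Measure Ω) {n : ℕ} (lam : ℝ)
    (gap : ℕ → Ω → ℝ) (node : ℕ → Ω → Fin n) : Prop where
  measurable_gap : ∀ k, Measurable (gap k)
  measurable_node : ∀ k, Measurable (node k)
  law : ∀ k, P.map (fun ω => (gap k ω, node k ω)) =
    (expMeasure (lam * n)).prod (uniformOn Set.univ)
  indep : iIndepFun (fun k ω => (gap k ω, node k ω)) P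

end RegulatedRepair

/-! ### Regulators and the inversion of travel times. -/

namespace RegulatedRepair

/-! Pathwise comparison. The erased fragments of an object are the nodes that failed since the first
failure `i` it met. The queue moves at the pace of its most demanding object, so the object at the
tail at failure `i` is never behind the greedy critical object of `i`, which obeys its own demand
only. If an object is lost before its repair is completed, that greedy object is therefore also
still under repair and has seen the same set of nodes: every data loss is a greedy loss
(`greedyPosition_le_tailPosition`, `IsDataLoss.isGreedyLoss`).

Wald's identity. Let `K` be the number of the first greedy loss (infinite if there is none). The
data loss time is at least the sum of `gap k` over `k ≤ K`. The event `k ≤ K` depends on the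
failures before `k` only, hence is independent of `gap k`, and so MTTDL is at least `E[K + 1] / (lam
* n)` (`meanGreedyLossIndex_div_le_mttdl`).

Counting. If `K` is finite, the greedy loss comes from an object started at some `i ≤ K` that sees
more than `r` distinct failures. For fixed `i` this event depends on the failures from `i` on, so it
is independent of `i ≤ K` and has probability `q(>r)`. A union bound gives `1 ≤ E[K + 1] * q(>r)`
when `E[K + 1]` is finite (`one_le_meanGreedyLossIndex_mul`); otherwise MTTDL is infinite. Together
these give the bound even without subtracting `T`. -/

/-- A repair rate function on the unit square: bounded below by `c > 0`, non-increasing in the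
fraction of erased fragments and non-decreasing in the position. -/
structure IsRegulator (φ : ℝ → ℝ → ℝ) (c : ℝ) : Prop where
  pos : 0 < c
  lower : ∀ f ∈ Set.Icc (0 : ℝ) 1, ∀ x ∈ Set.Icc (0 : ℝ) 1, c ≤ φ f x
  antitone : ∀ x ∈ Set.Icc (0 : ℝ) 1, AntitoneOn (fun f => φ f x) (Set.Icc 0 1)
  monotone : ∀ f ∈ Set.Icc (0 : ℝ) 1, MonotoneOn (fun x => φ f x) (Set.Icc 0 1)

theorem card_div_mem_Icc {n : ℕ} (A : Finset (Fin n)) :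
    ((A.card : ℝ) / n) ∈ Set.Icc (0 : ℝ) 1 :=
  ⟨by positivity, div_le_one_of_le₀ (by exact_mod_cast card_finset_fin_le A) (by positivity)⟩

/-- Travel time is strictly increasing in the endpoint because the pace is at least `m > 0`.
Statements about positions thus become statements about integrals of the pace. -/
theorem advance_le_iff {g : ℝ → ℝ} {a m : ℝ} (hg : MonotoneOn g (Set.Ici a)) (hm0 : 0 < m)
    (hm : ∀ u, a ≤ u → m ≤ g u) {t : ℝ} (ht : 0 ≤ t) {b : ℝ} (hab : a ≤ b) :
    advance g a t ≤ b ↔ t ≤ ∫ u in a..b, g u := by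
  obtain ⟨h1, h2⟩ := advance_travel_time hg hm0 hm ht
  constructor
  · intro h
    have h3 := pace_lower hg hm h1 h
    have : 0 ≤ m * (b - advance g a t) := mul_nonneg hm0.le (by linarith)
    linarith
  · intro h
    by_contra! hlt
    have h3 := pace_lower hg hm hab hlt.le
    have : 0 < m * (advance g a t - b) := mul_pos hm0 (by linarith)
    linarith

/-- The pace of an object with erased fragments `A` that alone determines the repair rate. -/
noncomputable def soloPace {n : ℕ} (φ : ℝ → ℝ → ℝ) (mu : ℝ) (A : Finset (Fin n)) (y : ℝ) : ℝ :=
  φ (A.card / n) (min y 1) / mu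

/-! ### Sample paths: comparison of the queue with greedy critical objects. -/

section Pathwise

variable {n : ℕ} {φ : ℝ → ℝ → ℝ} {c mu : ℝ} {gap : ℕ → ℝ} {node : ℕ → Fin n}

theorem soloPace_monotoneOn (hφ : IsRegulator φ c) (hmu : 0 < mu) (A : Finset (Fin n)) {a : ℝ}
    (ha : 0 ≤ a) : MonotoneOn (soloPace φ mu A) (Set.Ici a) := fun _ hx _ hy hxy =>
  div_le_div_of_nonneg_right (hφ.monotone _ (card_div_mem_Icc A)
    ⟨le_min (ha.trans hx) zero_le_one, min_le_right _ _⟩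
    ⟨le_min (ha.trans hy) zero_le_one, min_le_right _ _⟩ (min_le_min_right 1 hxy)) hmu.le

theorem le_soloPace (hφ : IsRegulator φ c) (hmu : 0 < mu) (A : Finset (Fin n)) {a : ℝ}
    (ha : 0 ≤ a) (u : ℝ) (hu : a ≤ u) : c / mu ≤ soloPace φ mu A u :=
  div_le_div_of_nonneg_right (hφ.lower _ (card_div_mem_Icc A) _
    ⟨le_min (ha.trans hu) zero_le_one, min_le_right _ _⟩) hmu.le

theorem greedyPosition_succ (i m : ℕ) :
    greedyPosition φ mu gap node i (m + 1) =
      advance (soloPace φ mu (nodesSeen node i m)) (greedyPosition φ mu gap node i m)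
        (gap (i + m + 1)) := rfl

theorem nodesSeen_succ (i m : ℕ) :
    nodesSeen node i (m + 1) = insert (node (i + m + 1)) (nodesSeen node i m) := by
  rw [nodesSeen, Finset.range_add_one, Finset.image_insert]
  rfl

theorem greedyPosition_nonneg (hφ : IsRegulator φ c) (hmu : 0 < mu) (hgap : ∀ k, 0 ≤ gap k)
    (i m : ℕ) : 0 ≤ greedyPosition φ mu gap node i m := by
  induction m with
  | zero => exact le_rfl
  | succ m ih =>
    exact ih.trans (advance_travel_time (soloPace_monotoneOn hφ hmu _ ih) (div_pos hφ.pos hmu)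
      (le_soloPace hφ hmu _ ih) (hgap _)).1

theorem greedyPosition_monotone (hφ : IsRegulator φ c) (hmu : 0 < mu) (hgap : ∀ k, 0 ≤ gap k)
    (i : ℕ) : Monotone (greedyPosition φ mu gap node i) :=
  monotone_nat_of_le_succ fun m =>
    have h := greedyPosition_nonneg (node := node) hφ hmu hgap i m
    (advance_travel_time (soloPace_monotoneOn hφ hmu _ h) (div_pos hφ.pos hmu)
      (le_soloPace hφ hmu _ h) (hgap _)).1

theorem displacement_spec (hφ : IsRegulator φ c) (hmu : 0 < mu) (S : QueueState n) {t : ℝ}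
    (ht : 0 ≤ t) : 0 ≤ displacement φ mu S t ∧
      ∫ d in (0 : ℝ)..displacement φ mu S t, systemRepairTime φ mu (S.shift d) = t :=
  have h := systemRepairTime_shift hmu hφ.lower hφ.antitone hφ.monotone S
  advance_travel_time h.1 (div_pos hφ.pos hmu) (fun d _ => h.2 d) ht

theorem systemRepairTime_le (hφ : IsRegulator φ c) (hmu : 0 < mu) (S : QueueState n) {x : ℝ}
    (hx : x ∈ Set.Icc (0 : ℝ) 1) : systemRepairTime φ mu S ≤ φ ((S x).card / n) x / mu := by
  refine ciInf_le (f := fun x : Set.Icc (0 : ℝ) 1 => φ ((S x).card / n) x / mu) ⟨c / mu, ?_⟩ ⟨x, hx⟩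
  rintro _ ⟨y, rfl⟩
  exact div_le_div_of_nonneg_right (hφ.lower _ (card_div_mem_Icc _) _ y.2) hmu.le

/-- The position, at failure number `i + m`, of the object of the queue that is at the tail
immediately before failure number `i` (its motion being continued beyond position `1`). -/
noncomputable def tailPosition (φ : ℝ → ℝ → ℝ) (mu : ℝ) (gap : ℕ → ℝ) (node : ℕ → Fin n) (i : ℕ) :
    ℕ → ℝ
  | 0 => 0
  | m + 1 => tailPosition φ mu gap node i m +
      displacement φ mu (queueAfter φ mu gap node (i + m + 1)) (gap (i + m + 1))

theorem tailPosition_nonneg (hφ : IsRegulator φ c) (hmu : 0 < mu) (hgap : ∀ k, 0 ≤ gap k)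
    (i m : ℕ) : 0 ≤ tailPosition φ mu gap node i m := by
  induction m with
  | zero => exact le_rfl
  | succ m ih => exact add_nonneg ih (displacement_spec hφ hmu _ (hgap _)).1

theorem queueAfter_succ (k : ℕ) (x : ℝ) :
    queueAfter φ mu gap node (k + 1) x = insert (node k)
      ((queueAfter φ mu gap node k).shift
        (displacement φ mu (queueAfter φ mu gap node k) (gap k)) x) := rfl

/-- The erased fragments of an object are the nodes seen since some failure, and at that failure it
was not behind the tail. -/
theorem exists_queueAfter_eq_nodesSeen (k : ℕ) {x : ℝ} (hx : 0 ≤ x) :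
    ∃ i m, i + m = k ∧ tailPosition φ mu gap node i m ≤ x ∧
      queueAfter φ mu gap node (k + 1) x = nodesSeen node i m := by
  induction k generalizing x with
  | zero =>
    refine ⟨0, 0, rfl, hx, ?_⟩
    rw [queueAfter_succ]
    have hempty : ∀ d, QueueState.shift (queueAfter φ mu gap node 0) d x = ∅ := fun d =>
      ite_eq_iff.2 (by simpa [queueAfter] using lt_or_ge x d)
    rw [hempty]
    rfl
  | succ k ih =>
    rw [queueAfter_succ]
    by_cases h : x < displacement φ mu (queueAfter φ mu gap node (k + 1)) (gap (k + 1))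
    -- The object re-entered the queue since the previous failure, so failure `k + 1` is its first.
    · exact ⟨k + 1, 0, rfl, hx, by simp [QueueState.shift, h, nodesSeen]⟩
    · obtain ⟨i, m, rfl, h1, h2⟩ := ih (sub_nonneg.2 (not_lt.1 h))
      refine ⟨i, m + 1, rfl, ?_, ?_⟩
      · rw [tailPosition]
        linarith
      · rw [nodesSeen_succ, QueueState.shift, if_neg h, h2]

/-- Objects keep their order, so an object not behind the tail object of failure `i` has not been
replaced since that failure. -/
theorem nodesSeen_subset_queueAfter (hφ : IsRegulator φ c) (hmu : 0 < mu)
    (hgap : ∀ k, 0 ≤ gap k) (i m : ℕ) {x : ℝ} (hx : tailPosition φ mu gap node i m ≤ x) :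
    nodesSeen node i m ⊆ queueAfter φ mu gap node (i + m + 1) x := by
  induction m generalizing x with
  | zero => simp [nodesSeen, queueAfter]
  | succ m ih =>
    rw [tailPosition] at hx
    have h0 := tailPosition_nonneg (node := node) hφ hmu hgap i m
    rw [nodesSeen_succ, queueAfter_succ, QueueState.shift]
    refine Finset.insert_subset_insert _ ?_
    rw [← add_assoc, if_neg (by linarith)]
    exact ih (by linarith)

/-- The greedy critical object is never ahead of the object of the queue with the same start. -/
theorem greedyPosition_le_tailPosition (hφ : IsRegulator φ c) (hmu : 0 < mu)
    (hgap : ∀ k, 0 ≤ gap k) (i m : ℕ) (h1 : tailPosition φ mu gap node i m < 1) :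
    greedyPosition φ mu gap node i m ≤ tailPosition φ mu gap node i m := by
  induction m with
  | zero => exact le_rfl
  | succ m ih =>
    rw [tailPosition] at h1 ⊢
    rw [greedyPosition_succ]
    set S := queueAfter φ mu gap node (i + m + 1)
    set y := greedyPosition φ mu gap node i m
    set b := tailPosition φ mu gap node i m with hb
    set A := nodesSeen node i m
    obtain ⟨hd, hdt⟩ := displacement_spec hφ hmu S (hgap (i + m + 1))
    set d := displacement φ mu S (gap (i + m + 1))
    have hb0 : 0 ≤ b := tailPosition_nonneg hφ hmu hgap i m
    have hy0 : 0 ≤ y := greedyPosition_nonneg hφ hmu hgap i m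
    have hyb : y ≤ b := ih (by linarith)
    have hm0 := div_pos hφ.pos hmu
    have hmono := soloPace_monotoneOn hφ hmu A hy0
    rw [advance_le_iff hmono hm0 (le_soloPace hφ hmu A hy0) (hgap _) (by linarith)]
    -- The infimum is at most the demand of the tail object itself, which sits at `b + u ≤ 1` and
    -- has erased at least `A`; more erasures only lower `φ`.
    have hpace : ∀ u ∈ Set.Icc 0 d, systemRepairTime φ mu (S.shift u) ≤ soloPace φ mu A (b + u) := by
      intro u hu
      have hbu : b + u ∈ Set.Icc (0 : ℝ) 1 := ⟨by linarith [hu.1], by linarith [hu.2]⟩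
      refine (systemRepairTime_le hφ hmu (S.shift u) hbu).trans ?_
      rw [soloPace, min_eq_left hbu.2]
      refine div_le_div_of_nonneg_right
        (hφ.antitone _ hbu (card_div_mem_Icc _) (card_div_mem_Icc _) ?_) hmu.le
      have hsub : A ⊆ S.shift u (b + u) := by
        rw [QueueState.shift, if_neg (by linarith), add_sub_cancel_right]
        exact nodesSeen_subset_queueAfter hφ hmu hgap i m hb.ge
      gcongr
    have hsys := (systemRepairTime_shift hmu hφ.lower hφ.antitone hφ.monotone S).1
    have hshift : ∫ u in (0 : ℝ)..d, soloPace φ mu A (b + u) =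
        ∫ u in b..(b + d), soloPace φ mu A u := by
      rw [intervalIntegral.integral_comp_add_left (soloPace φ mu A) b, add_zero]
    have hle : gap (i + m + 1) ≤ ∫ u in b..(b + d), soloPace φ mu A u := by
      rw [← hdt, ← hshift]
      refine intervalIntegral.integral_mono_on hd (pace_integrable hsys le_rfl hd) ?_ hpace
      refine (MonotoneOn.intervalIntegrable ?_)
      intro u hu v hv huv
      rw [Set.uIcc_of_le hd] at hu hv
      exact hmono (by simp only [Set.mem_Ici]; linarith [hu.1])
        (by simp only [Set.mem_Ici]; linarith [hv.1]) (by linarith)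
    -- The greedy object starts at `y ≤ b`, and the stretch from `y` to `b` only adds travel time.
    have hsplit := intervalIntegral.integral_add_adjacent_intervals
      (pace_integrable hmono le_rfl hyb)
      (pace_integrable hmono hyb (show y ≤ b + d by linarith))
    have hfirst := pace_lower hmono (le_soloPace hφ hmu A hy0) le_rfl hyb
    rw [intervalIntegral.integral_same, sub_zero] at hfirst
    have : 0 ≤ c / mu * (b - y) := mul_nonneg hm0.le (by linarith)
    linarith

/-- At failure number `k` some greedy critical object has seen more than `r` distinct failures. -/
def IsGreedyLoss (φ : ℝ → ℝ → ℝ) (mu : ℝ) (gap : ℕ → ℝ) (node : ℕ → Fin n) (r k : ℕ) : Prop :=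
  ∃ i ≤ k, greedyPosition φ mu gap node i (k - i) < 1 ∧ r < (nodesSeen node i (k - i)).card

theorem IsDataLoss.isGreedyLoss (hφ : IsRegulator φ c) (hmu : 0 < mu) (hgap : ∀ k, 0 ≤ gap k)
    {r k : ℕ} (h : IsDataLoss φ mu gap node r k) : IsGreedyLoss φ mu gap node r k := by
  obtain ⟨x, hx, hcard⟩ := h
  obtain ⟨i, m, rfl, htail, heq⟩ :=
    exists_queueAfter_eq_nodesSeen (φ := φ) (mu := mu) (gap := gap) (node := node) k hx.1
  have h1 := htail.trans_lt hx.2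
  refine ⟨i, Nat.le_add_right i m, ?_⟩
  rw [Nat.add_sub_cancel_left, ← heq]
  exact ⟨(greedyPosition_le_tailPosition hφ hmu hgap i m h1).trans_lt h1, hcard⟩

theorem card_nodesSeen_le_greedyCount (hφ : IsRegulator φ c) (hmu : 0 < mu)
    (hgap : ∀ k, 0 ≤ gap k) {i m : ℕ} (h : greedyPosition φ mu gap node i m < 1) :
    (nodesSeen node i m).card ≤ greedyCount φ mu gap node i := by
  rw [← Set.ncard_coe_finset]
  refine Set.ncard_le_ncard (fun v hv => ?_) (Set.toFinite _)
  obtain ⟨j, hj, rfl⟩ := Finset.mem_image.1 hv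
  exact ⟨j, (greedyPosition_monotone hφ hmu hgap i
    (Nat.lt_succ_iff.1 (Finset.mem_range.1 hj))).trans_lt h, rfl⟩

/-- No greedy critical object has seen more than `r` distinct failures before failure number `k`. -/
def NoGreedyLossBefore (φ : ℝ → ℝ → ℝ) (mu : ℝ) (gap : ℕ → ℝ) (node : ℕ → Fin n) (r k : ℕ) : Prop :=
  ∀ j < k, ¬ IsGreedyLoss φ mu gap node r j

-- The terms after the first greedy loss vanish, and a data loss cannot precede it. Writing the
-- stopped sum with indicators prepares Wald's identity.
open Classical in
theorem tsum_gap_le_dataLossTime (hφ : IsRegulator φ c) (hmu : 0 < mu) (hgap : ∀ k, 0 ≤ gap k)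
    (r : ℕ) : ∑' k, (if NoGreedyLossBefore φ mu gap node r k then ENNReal.ofReal (gap k) else 0) ≤
      dataLossTime φ mu gap node r := by
  refine le_iInf₂ fun k hk => ?_
  rw [tsum_eq_sum (s := Finset.range (k + 1)), failureTime,
    ENNReal.ofReal_sum_of_nonneg fun j _ => hgap j]
  · refine Finset.sum_le_sum fun j _ => ?_
    split_ifs <;> simp
  · intro j hj
    refine if_neg fun h => h k ?_ (hk.isGreedyLoss hφ hmu hgap)
    simpa using hj

/-- Among the greedy critical objects started up to the first greedy loss, one sees more than `r`
distinct failures. -/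
theorem exists_greedyCount_gt (hφ : IsRegulator φ c) (hmu : 0 < mu) (hgap : ∀ k, 0 ≤ gap k)
    {r : ℕ} (h : ∃ k, ¬ NoGreedyLossBefore φ mu gap node r k) :
    ∃ k, NoGreedyLossBefore φ mu gap node r k ∧ r < greedyCount φ mu gap node k := by
  classical
  have h' : ∃ k, IsGreedyLoss φ mu gap node r k := by
    obtain ⟨k, hk⟩ := h
    simp only [NoGreedyLossBefore, not_forall, not_not] at hk
    obtain ⟨j, -, hj⟩ := hk
    exact ⟨j, hj⟩
  -- The starting failure `i` does not exceed the first greedy loss, so no greedy loss occurs before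
  -- `i`.
  obtain ⟨i, hi, hpos, hcard⟩ := Nat.find_spec h'
  exact ⟨i, fun j hj => Nat.find_min h' (hj.trans_le hi),
    hcard.trans_le (card_nodesSeen_le_greedyCount hφ hmu hgap hpos)⟩

/-- Only failures from number `i` on enter the greedy motion, which is why its law does not depend
on `i`. -/
theorem greedyPosition_shift (i m : ℕ) :
    greedyPosition φ mu gap node i m =
      greedyPosition φ mu (fun k => gap (i + k)) (fun k => node (i + k)) 0 m := by
  induction m with
  | zero => rfl
  | succ m ih => simp only [greedyPosition, ih, nodesSeen, zero_add, add_assoc]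

theorem greedyCount_shift (i : ℕ) :
    greedyCount φ mu gap node i =
      greedyCount φ mu (fun k => gap (i + k)) (fun k => node (i + k)) 0 := by
  simp only [greedyCount, greedyPosition_shift i, zero_add]

end Pathwise


/-! ### Mean and support of the exponential law. -/

theorem lintegral_ofReal_expMeasure {rate : ℝ} (h : 0 < rate) :
    ∫⁻ x, ENNReal.ofReal x ∂expMeasure rate = (ENNReal.ofReal rate)⁻¹ := by
  have hmeas : ∀ a, Measurable (gammaPDF a rate) := fun a =>
    (measurable_gammaPDFReal a rate).ennreal_ofReal
  -- Multiplying the exponential density by `x` gives a multiple of the density of shape `2`, whose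
  -- total mass is known.
  have hpdf : ∀ x, gammaPDF 1 rate x * ENNReal.ofReal x =
      (ENNReal.ofReal rate)⁻¹ * gammaPDF 2 rate x := by
    intro x
    rcases lt_or_ge x 0 with hx | hx
    · simp [gammaPDF_of_neg hx]
    · rw [gammaPDF_of_nonneg hx, gammaPDF_of_nonneg hx, ← ENNReal.ofReal_mul' hx,
        ← ENNReal.ofReal_inv_of_pos h, ← ENNReal.ofReal_mul (by positivity)]
      congr 1
      norm_num
      field_simp
  change ∫⁻ x, ENNReal.ofReal x ∂(volume.withDensity (gammaPDF 1 rate)) = _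
  rw [lintegral_withDensity_eq_lintegral_mul _ (hmeas 1) ENNReal.measurable_ofReal]
  simp only [Pi.mul_apply, hpdf]
  rw [lintegral_const_mul _ (hmeas 2), lintegral_gammaPDF_eq_one two_pos h, mul_one]

theorem expMeasure_ae_nonneg (rate : ℝ) : ∀ᵐ x ∂expMeasure rate, 0 ≤ x := by
  rw [ae_iff]
  have : {x : ℝ | ¬ 0 ≤ x} = Set.Iio 0 := by ext; simp
  rw [this]
  change (volume.withDensity (gammaPDF 1 rate)) (Set.Iio 0) = 0
  rw [withDensity_apply _ measurableSet_Iio]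
  exact lintegral_gammaPDF_of_nonpos le_rfl

/-! ### Measurability with respect to past or future failures. -/

section Measurability

instance {n : ℕ} : MeasurableSpace (Finset (Fin n)) := ⊤

instance {n : ℕ} : DiscreteMeasurableSpace (Finset (Fin n)) := ⟨fun _ => trivial⟩

variable {Ω : Type*} {mΩ : MeasurableSpace Ω} {n : ℕ} {φ : ℝ → ℝ → ℝ} {c mu : ℝ}
  {gap : ℕ → Ω → ℝ} {node : ℕ → Ω → Fin n}

/-- Measurability is required only for the failures involved, here and below, so that these lemmas
also apply to the sub-σ-algebras generated by the past or the future. -/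
theorem measurable_nodesSeen {i m : ℕ} (hnode : ∀ j, i ≤ j → j ≤ i + m → Measurable (node j)) :
    Measurable fun ω => nodesSeen (fun j => node j ω) i m := by
  induction m with
  | zero =>
    simp only [nodesSeen, zero_add, Finset.range_one, Finset.image_singleton, add_zero]
    exact (Measurable.of_discrete (f := fun v : Fin n => ({v} : Finset (Fin n)))).comp
      (hnode i le_rfl le_rfl)
  | succ m ih =>
    simp only [nodesSeen_succ]
    exact (Measurable.of_discrete (f := fun p : Fin n × Finset (Fin n) => insert p.1 p.2)).comp
      ((hnode _ (by omega) (by omega)).prodMk (ih fun j h1 h2 => hnode j h1 (by omega)))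

/-- By `advance_le_iff` the sublevel sets are given by travel times measured from `0`, which are
monotone in the start. Truncation at `0` keeps start and duration in the range where the pace is
controlled. -/
theorem measurable_advance_soloPace (hφ : IsRegulator φ c) (hmu : 0 < mu) :
    Measurable fun p : Finset (Fin n) × ℝ × ℝ =>
      advance (soloPace φ mu p.1) (max p.2.1 0) (max p.2.2 0) := by
  refine measurable_from_prod_countable_right fun A => measurable_of_Iic fun b => ?_
  have hm0 := div_pos hφ.pos hmu
  have hmono := fun a ha => soloPace_monotoneOn hφ hmu A (a := a) ha
  have hlow := fun a ha => le_soloPace hφ hmu A (a := a) ha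
  have hprim : Monotone fun a : ℝ => ∫ u in (0 : ℝ)..max a 0, soloPace φ mu A u := by
    intro a a' h
    have h1 := pace_lower (hmono 0 le_rfl) (hlow 0 le_rfl) (le_max_right a 0) (max_le_max_right 0 h)
    have : 0 ≤ c / mu * (max a' 0 - max a 0) :=
      mul_nonneg hm0.le (sub_nonneg.2 (max_le_max_right 0 h))
    simp only
    linarith
  have hset : (fun p : ℝ × ℝ => advance (soloPace φ mu A) (max p.1 0) (max p.2 0)) ⁻¹' Set.Iic b =
      {p | max p.1 0 ≤ b} ∩ {p | max p.2 0 ≤ (∫ u in (0 : ℝ)..b, soloPace φ mu A u) -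
        ∫ u in (0 : ℝ)..max p.1 0, soloPace φ mu A u} := by
    ext ⟨a, t⟩
    simp only [Set.mem_preimage, Set.mem_Iic, Set.mem_inter_iff, Set.mem_ofPred_eq]
    have ha := le_max_right a 0
    have ht := le_max_right t 0
    by_cases hab : max a 0 ≤ b
    · rw [intervalIntegral.integral_interval_sub_left
        (pace_integrable (hmono 0 le_rfl) le_rfl (ha.trans hab))
        (pace_integrable (hmono 0 le_rfl) le_rfl ha),
        advance_le_iff (hmono _ ha) hm0 (hlow _ ha) ht hab]
      exact ⟨fun h => ⟨hab, h⟩, fun h => h.2⟩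
    · exact ⟨fun h => absurd ((advance_travel_time (hmono _ ha) hm0 (hlow _ ha) ht).1.trans h) hab,
        fun h => absurd h.1 hab⟩
  rw [hset]
  refine (measurableSet_le (measurable_fst.max measurable_const) measurable_const).inter
    (measurableSet_le (measurable_snd.max measurable_const)
      (measurable_const.sub (hprim.measurable.comp measurable_fst)))

theorem measurable_greedyPosition (hφ : IsRegulator φ c) (hmu : 0 < mu)
    (hgap : ∀ k ω, 0 ≤ gap k ω) {i m : ℕ}
    (hg : ∀ j, i ≤ j → j ≤ i + m → Measurable (gap j))
    (hnode : ∀ j, i ≤ j → j ≤ i + m → Measurable (node j)) :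
    Measurable fun ω => greedyPosition φ mu (fun k => gap k ω) (fun k => node k ω) i m := by
  induction m with
  | zero => exact measurable_const
  | succ m ih =>
    have h := (measurable_advance_soloPace (n := n) hφ hmu).comp
      ((measurable_nodesSeen (node := node) (i := i) (m := m)
        fun j h1 h2 => hnode j h1 (by omega)).prodMk
        ((ih (fun j h1 h2 => hg j h1 (by omega)) fun j h1 h2 => hnode j h1 (by omega)).prodMk
          (hg (i + m + 1) (by omega) (by omega))))
    convert h using 2 with ω
    simp only [Function.comp_apply]
    rw [max_eq_left (hgap _ ω),
      max_eq_left (greedyPosition_nonneg hφ hmu (fun k => hgap k ω) i m), greedyPosition_succ]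

theorem measurable_greedyCount (hφ : IsRegulator φ c) (hmu : 0 < mu)
    (hgap : ∀ k ω, 0 ≤ gap k ω) {i : ℕ} (hg : ∀ j, i ≤ j → Measurable (gap j))
    (hnode : ∀ j, i ≤ j → Measurable (node j)) :
    Measurable fun ω => greedyCount φ mu (fun k => gap k ω) (fun k => node k ω) i := by
  classical
  have heq : (fun ω => greedyCount φ mu (fun k => gap k ω) (fun k => node k ω) i) = fun ω =>
      ∑ v : Fin n, if ∃ m, greedyPosition φ mu (fun k => gap k ω) (fun k => node k ω) i m < 1 ∧
        node (i + m) ω = v then 1 else 0 := by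
    ext ω
    rw [greedyCount, Set.ncard_eq_toFinset_card', Set.toFinset_ofPred, Finset.card_filter]
  rw [heq]
  refine Finset.measurable_sum _ fun v _ => Measurable.ite ?_ measurable_const measurable_const
  rw [Set.ofPred_exists]
  refine MeasurableSet.iUnion fun m => ?_
  exact (measurableSet_lt (measurable_greedyPosition hφ hmu hgap (fun j h1 _ => hg j h1)
    fun j h1 _ => hnode j h1) measurable_const).inter
    (hnode (i + m) (Nat.le_add_right i m) (measurableSet_singleton v))

theorem measurableSet_isGreedyLoss (hφ : IsRegulator φ c) (hmu : 0 < mu)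
    (hgap : ∀ k ω, 0 ≤ gap k ω) {r k : ℕ} (hg : ∀ j ≤ k, Measurable (gap j))
    (hnode : ∀ j ≤ k, Measurable (node j)) :
    MeasurableSet {ω | IsGreedyLoss φ mu (fun j => gap j ω) (fun j => node j ω) r k} := by
  simp only [IsGreedyLoss, Set.ofPred_exists]
  refine MeasurableSet.iUnion fun i => ?_
  by_cases hi : i ≤ k
  · simp only [hi, true_and]
    refine (measurableSet_lt (measurable_greedyPosition hφ hmu hgap (fun l _ h2 => hg l (by omega))
      fun l _ h2 => hnode l (by omega)) measurable_const).inter ?_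
    exact (measurable_nodesSeen fun l _ h2 => hnode l (by omega))
      (MeasurableSet.of_discrete (s := {A : Finset (Fin n) | r < A.card}))
  · simp [hi]

theorem measurableSet_noGreedyLossBefore (hφ : IsRegulator φ c) (hmu : 0 < mu)
    (hgap : ∀ k ω, 0 ≤ gap k ω) {r k : ℕ} (hg : ∀ j < k, Measurable (gap j))
    (hnode : ∀ j < k, Measurable (node j)) :
    MeasurableSet {ω | NoGreedyLossBefore φ mu (fun j => gap j ω) (fun j => node j ω) r k} := by
  simp only [NoGreedyLossBefore, Set.ofPred_forall]
  exact MeasurableSet.iInter fun j => MeasurableSet.iInter fun hj =>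
    (measurableSet_isGreedyLoss hφ hmu hgap (fun l hl => hg l (hl.trans_lt hj))
      fun l hl => hnode l (hl.trans_lt hj)).compl

end Measurability

/-! ### Independence, Wald's identity and the counting argument. -/

section Probability

variable {Ω : Type*} [MeasurableSpace Ω] {P : Measure Ω} {n : ℕ} {lam : ℝ}
  {gap : ℕ → Ω → ℝ} {node : ℕ → Ω → Fin n}

theorem IsPoissonFailures.map_gap (h : IsPoissonFailures P lam gap node) (hn : 0 < n) (k : ℕ) :
    P.map (gap k) = expMeasure (lam * n) := by
  have : Nonempty (Fin n) := ⟨⟨0, hn⟩⟩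
  have : IsProbabilityMeasure (uniformOn (Set.univ : Set (Fin n))) :=
    isProbabilityMeasure_uniformOn Set.finite_univ Set.univ_nonempty
  have h1 : gap k = Prod.fst ∘ fun ω => (gap k ω, node k ω) := rfl
  rw [h1, ← Measure.map_map measurable_fst ((h.measurable_gap k).prodMk (h.measurable_node k)),
    h.law k, Measure.map_fst_prod]
  simp

theorem IsPoissonFailures.ae_gap_nonneg (h : IsPoissonFailures P lam gap node) (hn : 0 < n) :
    ∀ᵐ ω ∂P, ∀ k, 0 ≤ gap k ω := by
  refine ae_all_iff.2 fun k => ?_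
  have := expMeasure_ae_nonneg (lam * n)
  rw [← h.map_gap hn k] at this
  exact ae_of_ae_map (h.measurable_gap k).aemeasurable this

/-- Replaces almost surely nonnegative gaps by gaps nonnegative everywhere, as the pathwise lemmas
need. -/
theorem IsPoissonFailures.max_zero (h : IsPoissonFailures P lam gap node) (hn : 0 < n) :
    IsPoissonFailures P lam (fun k ω => max (gap k ω) 0) node where
  measurable_gap k := (h.measurable_gap k).max measurable_const
  measurable_node := h.measurable_node
  law k := by
    rw [← h.law k]
    refine Measure.map_congr ?_
    filter_upwards [h.ae_gap_nonneg hn] with ω hω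
    rw [max_eq_left (hω k)]
  indep := h.indep.comp (fun _ p => (max p.1 0, p.2)) fun _ =>
    (measurable_fst.max measurable_const).prodMk measurable_snd

theorem IsPoissonFailures.lintegral_gap (h : IsPoissonFailures P lam gap node) (hn : 0 < n)
    (hlam : 0 < lam) (k : ℕ) :
    ∫⁻ ω, ENNReal.ofReal (gap k ω) ∂P = (ENNReal.ofReal (lam * n))⁻¹ := by
  rw [← lintegral_map (μ := P) (g := gap k) ENNReal.measurable_ofReal (h.measurable_gap k),
    h.map_gap hn k, lintegral_ofReal_expMeasure (by positivity)]

/-- The failures before number `k` are independent of the failures from number `k` on. -/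
theorem IsPoissonFailures.indep_past_future (h : IsPoissonFailures P lam gap node) (k : ℕ) :
    Indep
      (⨆ j ∈ Set.Iio k, MeasurableSpace.comap (fun ω => (gap j ω, node j ω)) inferInstance)
      (⨆ j ∈ Set.Ici k, MeasurableSpace.comap (fun ω => (gap j ω, node j ω)) inferInstance) P :=
  indep_iSup_of_disjoint
    (fun j => ((h.measurable_gap j).prodMk (h.measurable_node j)).comap_le) h.indep
    (Set.disjoint_left.2 fun _ h1 h2 => not_le.2 (Set.mem_Iio.1 h1) (Set.mem_Ici.1 h2))

theorem measurable_gap_node_iSup_comap {Ω : Type*} {gap : ℕ → Ω → ℝ} {node : ℕ → Ω → Fin n} {s : Set ℕ} {j : ℕ} (hj : j ∈ s) :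
    Measurable[⨆ j ∈ s, MeasurableSpace.comap (fun ω => (gap j ω, node j ω)) inferInstance]
      (gap j) ∧
    Measurable[⨆ j ∈ s, MeasurableSpace.comap (fun ω => (gap j ω, node j ω)) inferInstance]
      (node j) := by
  have h : Measurable[⨆ j ∈ s, MeasurableSpace.comap (fun ω => (gap j ω, node j ω)) inferInstance]
      fun ω => (gap j ω, node j ω) :=
    (comap_measurable _).mono (le_iSup₂_of_le j hj le_rfl) le_rfl
  exact ⟨measurable_fst.comp h, measurable_snd.comp h⟩

theorem IsPoissonFailures.map_shift [IsProbabilityMeasure P]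
    (h : IsPoissonFailures P lam gap node) (i : ℕ) :
    P.map (fun ω k => (gap (i + k) ω, node (i + k) ω)) =
      Measure.infinitePi fun _ => (expMeasure (lam * n)).prod (uniformOn Set.univ) := by
  have h1 := (h.indep.precomp (g := fun k => i + k) (add_right_injective i))
  have h2 := h1.map_fun_eq_infinitePi_map
    (fun k => (h.measurable_gap (i + k)).prodMk (h.measurable_node (i + k)))
  simp only [h.law] at h2
  exact h2

variable {φ : ℝ → ℝ → ℝ} {c mu : ℝ}

/-- The number of distinct failures seen by the greedy critical object has the same law for every
failure. -/
theorem IsPoissonFailures.greedyDistribution_eq [IsProbabilityMeasure P]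
    (h : IsPoissonFailures P lam gap node) (hφ : IsRegulator φ c) (hmu : 0 < mu)
    (hgap : ∀ k ω, 0 ≤ gap k ω) (i : ℕ) :
    greedyDistribution P φ mu gap node i =
      (Measure.infinitePi fun _ : ℕ => (expMeasure (lam * n)).prod (uniformOn Set.univ)).map
        fun w : ℕ → ℝ × Fin n =>
          greedyCount φ mu (fun k => max (w k).1 0) (fun k => (w k).2) 0 := by
  have hcount : Measurable fun w : ℕ → ℝ × Fin n =>
      greedyCount φ mu (fun k => max (w k).1 0) (fun k => (w k).2) 0 :=
    measurable_greedyCount (gap := fun k (w : ℕ → ℝ × Fin n) => max (w k).1 0)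
      (node := fun k (w : ℕ → ℝ × Fin n) => (w k).2) hφ hmu
      (fun _ _ => le_max_right _ _)
      (fun j _ => (measurable_pi_apply j).fst.max measurable_const)
      (fun j _ => (measurable_pi_apply j).snd)
  rw [← h.map_shift i, Measure.map_map hcount (measurable_pi_lambda _ fun k =>
    (h.measurable_gap (i + k)).prodMk (h.measurable_node (i + k))), greedyDistribution]
  congr 1
  ext ω
  rw [greedyCount_shift]
  simp only [Function.comp_apply, max_eq_left (hgap _ ω)]

/-- The expected number of failures up to the first greedy loss. -/
noncomputable def meanGreedyLossIndex (P : Measure Ω) (φ : ℝ → ℝ → ℝ) (mu : ℝ) (gap : ℕ → Ω → ℝ)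
    (node : ℕ → Ω → Fin n) (r : ℕ) : ENNReal :=
  ∑' k, P {ω | NoGreedyLossBefore φ mu (fun j => gap j ω) (fun j => node j ω) r k}

/-- Wald's identity for the time of the first greedy loss, which bounds the data loss time. -/
theorem IsPoissonFailures.meanGreedyLossIndex_div_le_mttdl (h : IsPoissonFailures P lam gap node)
    (hn : 0 < n) (hlam : 0 < lam) (hφ : IsRegulator φ c) (hmu : 0 < mu)
    (hgap : ∀ k ω, 0 ≤ gap k ω) (r : ℕ) :
    meanGreedyLossIndex P φ mu gap node r * (ENNReal.ofReal (lam * n))⁻¹ ≤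
      mttdl P φ mu gap node r := by
  classical
  set S : ℕ → Set Ω := fun k =>
    {ω | NoGreedyLossBefore φ mu (fun j => gap j ω) (fun j => node j ω) r k} with hS
  have hSm : ∀ k, MeasurableSet (S k) := fun k => measurableSet_noGreedyLossBefore hφ hmu hgap
    (fun j _ => h.measurable_gap j) fun j _ => h.measurable_node j
  -- `S k` involves only failures numbered below `k`, while `gap k` belongs to the future.
  have hterm : ∀ k, ∫⁻ ω, (S k).indicator 1 ω * ENNReal.ofReal (gap k ω) ∂P =
      P (S k) * (ENNReal.ofReal (lam * n))⁻¹ := by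
    intro k
    rw [lintegral_mul_eq_lintegral_mul_lintegral_of_independent_measurableSpace
      (iSup₂_le fun j _ => ((h.measurable_gap j).prodMk (h.measurable_node j)).comap_le)
      (iSup₂_le fun j _ => ((h.measurable_gap j).prodMk (h.measurable_node j)).comap_le)
      (h.indep_past_future k), h.lintegral_gap hn hlam k, lintegral_indicator_one (hSm k)]
    · refine Measurable.indicator (@measurable_const _ _ _ (_) _) ?_
      exact measurableSet_noGreedyLossBefore hφ hmu hgap
        (fun j hj => (measurable_gap_node_iSup_comap (s := Set.Iio k) hj).1)
        (fun j hj => (measurable_gap_node_iSup_comap (s := Set.Iio k) hj).2)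
    · exact ENNReal.measurable_ofReal.comp
        (measurable_gap_node_iSup_comap (s := Set.Ici k) (node := node) (Set.mem_Ici.2 le_rfl)).1
  calc meanGreedyLossIndex P φ mu gap node r * (ENNReal.ofReal (lam * n))⁻¹
      = ∑' k, ∫⁻ ω, (S k).indicator 1 ω * ENNReal.ofReal (gap k ω) ∂P := by
        simp only [hterm, ENNReal.tsum_mul_right]
        rfl
    _ = ∫⁻ ω, ∑' k, (S k).indicator 1 ω * ENNReal.ofReal (gap k ω) ∂P :=
        (lintegral_tsum fun k => ((measurable_one.indicator (hSm k)).mul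
          (h.measurable_gap k).ennreal_ofReal).aemeasurable).symm
    _ ≤ mttdl P φ mu gap node r := by
        refine lintegral_mono fun ω => ?_
        refine le_trans (le_of_eq ?_)
          (tsum_gap_le_dataLossTime (node := fun j => node j ω) hφ hmu (fun k => hgap k ω) r)
        refine tsum_congr fun k => ?_
        simp [Set.indicator_apply, hS]

/-- Counting the greedy critical objects that see more than `r` distinct failures, up to the first
greedy loss. -/
theorem IsPoissonFailures.one_le_meanGreedyLossIndex_mul [IsProbabilityMeasure P]
    (h : IsPoissonFailures P lam gap node) (hφ : IsRegulator φ c) (hmu : 0 < mu)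
    (hgap : ∀ k ω, 0 ≤ gap k ω) (r i : ℕ)
    (hfin : meanGreedyLossIndex P φ mu gap node r ≠ ⊤) :
    1 ≤ meanGreedyLossIndex P φ mu gap node r *
      greedyDistribution P φ mu gap node i (Set.Ioi r) := by
  classical
  set S : ℕ → Set Ω := fun k =>
    {ω | NoGreedyLossBefore φ mu (fun j => gap j ω) (fun j => node j ω) r k} with hS
  have hSm : ∀ k, MeasurableSet (S k) := fun k => measurableSet_noGreedyLossBefore hφ hmu hgap
    (fun j _ => h.measurable_gap j) fun j _ => h.measurable_node j
  set Z : ℕ → Set Ω := fun k =>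
    {ω | r < greedyCount φ mu (fun j => gap j ω) (fun j => node j ω) k} with hZ
  have hcount : ∀ k, Measurable fun ω =>
      greedyCount φ mu (fun j => gap j ω) (fun j => node j ω) k := fun k =>
    measurable_greedyCount hφ hmu hgap (fun j _ => h.measurable_gap j)
      fun j _ => h.measurable_node j
  have hPZ : ∀ k, P (Z k) = greedyDistribution P φ mu gap node i (Set.Ioi r) := by
    intro k
    rw [h.greedyDistribution_eq hφ hmu hgap i, ← h.greedyDistribution_eq hφ hmu hgap k,
      greedyDistribution, Measure.map_apply (hcount k) measurableSet_Ioi]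
    rfl
  have hinter : ∀ k, P (S k ∩ Z k) =
      P (S k) * greedyDistribution P φ mu gap node i (Set.Ioi r) := by
    intro k
    rw [← hPZ k]
    refine (Indep_iff _ _ P).1 (h.indep_past_future k) _ _ ?_ ?_
    · exact measurableSet_noGreedyLossBefore hφ hmu hgap
        (fun j hj => (measurable_gap_node_iSup_comap (s := Set.Iio k) hj).1)
        (fun j hj => (measurable_gap_node_iSup_comap (s := Set.Iio k) hj).2)
    · exact measurable_greedyCount hφ hmu hgap
        (fun j hj => (measurable_gap_node_iSup_comap (s := Set.Ici k) hj).1)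
        (fun j hj => (measurable_gap_node_iSup_comap (s := Set.Ici k) hj).2)
        (measurableSet_Ioi (a := r))
  -- Otherwise every term of the series `meanGreedyLossIndex` would be at least the same positive
  -- number.
  have hnever : P (⋂ k, S k) = 0 := by
    by_contra h0
    refine hfin (top_unique ?_)
    rw [← ENNReal.tsum_const_eq_top_of_ne_zero (α := ℕ) h0]
    exact ENNReal.tsum_le_tsum fun k => measure_mono (Set.iInter_subset S k)
  have hcover : Set.univ ⊆ (⋂ k, S k) ∪ ⋃ k, S k ∩ Z k := by
    intro ω _
    by_cases hω : ω ∈ ⋂ k, S k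
    · exact Or.inl hω
    · obtain ⟨k, hk⟩ := exists_greedyCount_gt (φ := φ) (node := fun j => node j ω) (r := r) hφ hmu
        (fun k => hgap k ω) (by simpa [hS] using hω)
      exact Or.inr (Set.mem_iUnion.2 ⟨k, hk⟩)
  calc (1 : ENNReal) = P Set.univ := measure_univ.symm
    _ ≤ P (⋂ k, S k) + P (⋃ k, S k ∩ Z k) := (measure_mono hcover).trans (measure_union_le _ _)
    _ ≤ ∑' k, P (S k ∩ Z k) := by
        rw [hnever, zero_add]
        exact measure_iUnion_le _
    _ = _ := by
        simp only [hinter, ENNReal.tsum_mul_right]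
        rfl

theorem IsPoissonFailures.one_div_le_mttdl [IsProbabilityMeasure P]
    (h : IsPoissonFailures P lam gap node) (hn : 0 < n) (hlam : 0 < lam) (hφ : IsRegulator φ c)
    (hmu : 0 < mu) (r i : ℕ) :
    1 / (ENNReal.ofReal (lam * n) * greedyDistribution P φ mu gap node i (Set.Ioi r)) ≤
      mttdl P φ mu gap node r := by
  have hmax : ∀ᵐ ω ∂P, (fun k => max (gap k ω) 0) = fun k => gap k ω := by
    filter_upwards [h.ae_gap_nonneg hn] with ω hω
    exact funext fun k => max_eq_left (hω k)
  have hq : greedyDistribution P φ mu gap node i =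
      greedyDistribution P φ mu (fun k ω => max (gap k ω) 0) node i :=
    Measure.map_congr (hmax.mono fun ω hω => by simp only [hω])
  have hm : mttdl P φ mu gap node r = mttdl P φ mu (fun k ω => max (gap k ω) 0) node r :=
    lintegral_congr_ae (hmax.mono fun ω hω => by simp only [hω])
  have h' := h.max_zero hn
  have hgap : ∀ k ω, 0 ≤ (fun k ω => max (gap k ω) 0) k ω := fun _ _ => le_max_right _ _
  rw [hq, hm]
  have hrate : ENNReal.ofReal (lam * n) ≠ 0 := by
    have : 0 < lam * n := by positivity
    simpa using this
  refine le_trans ?_ (h'.meanGreedyLossIndex_div_le_mttdl hn hlam hφ hmu hgap r)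
  rw [one_div, ENNReal.mul_inv (Or.inl hrate) (Or.inl ENNReal.ofReal_ne_top), mul_comm]
  refine mul_le_mul_left ?_ _
  -- When `q(>r)` is zero only the infinite case can occur, in accordance with `1 / 0 = ⊤`.
  by_cases hfin : meanGreedyLossIndex P φ mu (fun k ω => max (gap k ω) 0) node r = ⊤
  · rw [hfin]
    exact le_top
  · have h1 := h'.one_le_meanGreedyLossIndex_mul hφ hmu hgap r i hfin
    rw [← one_div]
    exact ENNReal.div_le_of_le_mul h1

end Probability

end RegulatedRepair

theorem mainTheorem2 {Ω : Type*} [MeasurableSpace Ω] (P : Measure Ω) [IsProbabilityMeasure P]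
    (n r : ℕ) (hn : 0 < n)
    -- actual and assumed node failure rate, and nominal system repair time
    (lam lamHat T : ℝ) (hlam : 0 < lam) (hlamHat : 0 < lamHat)
    (φ : ℝ → ℝ → ℝ) (hT : lamHat * T = φ 0 0)
    (hφ_pos : ∃ c > 0, ∀ f ∈ Set.Icc (0 : ℝ) 1, ∀ x ∈ Set.Icc (0 : ℝ) 1, c ≤ φ f x)
    (hφ_f : ∀ x ∈ Set.Icc (0 : ℝ) 1, AntitoneOn (fun f => φ f x) (Set.Icc 0 1))
    (hφ_x : ∀ f ∈ Set.Icc (0 : ℝ) 1, MonotoneOn (fun x => φ f x) (Set.Icc 0 1))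
    (gap : ℕ → Ω → ℝ) (node : ℕ → Ω → Fin n) (hfail : RegulatedRepair.IsPoissonFailures P lam gap node)
    (i : ℕ) :
    1 / (ENNReal.ofReal (lam * n) *
        RegulatedRepair.greedyDistribution P φ lamHat gap node i (Set.Ioi r))
        - ENNReal.ofReal T
      ≤ RegulatedRepair.mttdl P φ lamHat gap node r := by
  obtain ⟨c, hc, hlow⟩ := hφ_pos
  -- Subtracting `T` only weakens the bound. The truncation of the subtraction at `0` loses nothing,
  -- as MTTDL is nonnegative, and `⊤` minus a finite value stays `⊤`.
  exact tsub_le_self.trans (hfail.one_div_le_mttdl hn hlam ⟨hc, hlow, hφ_f, hφ_x⟩ hlamHat r i)
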